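/- Let $\Omega$ be the set of countable (nonzero) limit ordinals. A ladder system on $\omega_1$ is a sequence $\bar C=\langle C_\eta:\eta\in\Omega\rangle$ such that each $C_\eta$ is a cofinal subset of $\eta$ of order type $\omega$; write $C_\eta(i)$ for the $\alpha\in C_\eta$ with $|C_\eta\cap\alpha|=i$. A partial function $F\colon 2^\omega\to 2$ is dense if for every finite sequence $s\in 2^{<\omega}$ both values $0,1$ are attained by $F$ at points of $\operatorname{dom}(F)$ extending $s$. Given a ladder system $\bar C$ on $\omega_1$, a dense partial function $F\colon 2^\omega\to2$ and a function $g\colon\Omega\to2$, let $Q_{\bar C,F,g}$ be the set of functions $p\colon\delta_p\to 2$, with $\delta_p$ a countable ordinal, such that for every $\eta\in\Omega$ with $\eta\le\delta_p$ the sequence $\langle p(C_\eta(i)):i<\omega\rangle$ is in $\operatorname{dom}(F)$ and $F(\langle p(C_\eta(i)):i<\omega\rangle)=g(\eta)$, ordered by extension ($q\le p$ iff $q\supseteq p$). Then for all such $\bar C$, $F$, $g$ the partial order $P=Q_{\bar C,F,g}$ has the following properties. (1) $P$ is proper: for every regular uncountable cardinal $\theta>2^{|P|}$ with $P\in H(\theta)$,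 every countable elementary substructure $X\prec(H(\theta),\in)$ with $(P,\le)\in X$ and every $p\in P\cap X$, there is a $q\le p$ which is $(X,P)$-generic, i.e. for every dense $D\subseteq P$ with $D\in X$, every $r\le q$ is compatible with some element of $D\cap X$. (2) $P$ is $(\omega,\infty)$-distributive: the intersection of countably many dense open subsets of $P$ is dense. (3) In particular, forcing with $P$ adds no new elements of $\omega^\omega$: whenever $\dot x$ is a $P$-name and $q\in P$ forces $\dot x\in\omega^\omega$, there are $r\le q$ and $y\in\omega^\omega$ in the ground model such that $r$ forces $\dot x=\check y$. -/

import Mathlib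

universe u

namespace LadderForcing

open Ordinal Cardinal

/-! ### Ladder systems, dense partial functions and the forcing -/

/-- `Ω`: the set of countable (nonzero) limit ordinals. -/
def Omega : Set Ordinal.{0} := {η | Order.IsSuccLimit η ∧ η < ω₁}

/-- A ladder system on `ω₁`: each `C η` (`η ∈ Ω`) is a cofinal subset of `η` of order type `ω`. -/
structure LadderSystem where
  C : Omega → Set Ordinal.{0}
  subset : ∀ η : Omega, C η ⊆ Set.Iio (η : Ordinal)
  cofinal : ∀ η : Omega, ∀ α < (η : Ordinal), ∃ β ∈ C η, α ≤ β
  orderType : ∀ η : Omega, Nonempty (ℕ ≃o C η)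

/-- `C(n)`: the unique `α ∈ C` such that `C ∩ α` has exactly `n` elements. -/
noncomputable def nthElem (C : Set Ordinal.{0}) (n : ℕ) : Ordinal.{0} :=
  sInf {α | α ∈ C ∧ (C ∩ Set.Iio α).encard = n}

theorem nthElem_spec {C : Set Ordinal.{0}} (h : Nonempty (ℕ ≃o C)) (n : ℕ) :
    nthElem C n ∈ C ∧ (C ∩ Set.Iio (nthElem C n)).encard = n := by
  obtain ⟨e⟩ := h
  refine csInf_mem (s := {α | α ∈ C ∧ (C ∩ Set.Iio α).encard = n}) ⟨e n, (e n).2, ?_⟩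
  have : C ∩ Set.Iio (e n : Ordinal) = (fun k => (e k : Ordinal)) '' Set.Iio n := by
    ext x
    constructor
    · rintro ⟨hx, hlt⟩
      refine ⟨e.symm ⟨x, hx⟩, ?_, by simp⟩
      have : (⟨x, hx⟩ : C) < e n := hlt
      simpa using e.symm.lt_iff_lt.mpr this
    · rintro ⟨k, hk, rfl⟩
      exact ⟨(e k).2, e.lt_iff_lt.mpr hk⟩
  rw [this, Function.Injective.encard_image
    (f := fun k => (e k : Ordinal)) (Subtype.val_injective.comp e.injective),
    Set.encard_eq_coe_toFinset_card]
  simp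

theorem LadderSystem.nthElem_lt (L : LadderSystem) (η : Omega) (n : ℕ) :
    nthElem (L.C η) n < (η : Ordinal) :=
  L.subset η (nthElem_spec (L.orderType η) n).1

/-- The basic clopen set `[s]` of extensions in `2^ω` of a finite sequence `s ∈ 2^n`. -/
def cyl {n : ℕ} (s : Fin n → Fin 2) : Set (ℕ → Fin 2) := {x | ∀ i : Fin n, x i = s i}

/-- A partial function `F : 2^ω → 2` is dense if `F[[s] ∩ dom F] = 2` for every `s ∈ 2^{<ω}`. -/
def IsDenseFn (F : (ℕ → Fin 2) →. Fin 2) : Prop :=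
  ∀ (n : ℕ) (s : Fin n → Fin 2), F.image (cyl s) = Set.univ

/-- The conditions of `Q_{C,F,g}`: functions `p : δ → 2`, `δ` a countable ordinal, such that for all
`η ∈ (δ + 1) ∩ Ω` the sequence `⟨p (C_η(i)) : i < ω⟩` is in `dom F` and is mapped by `F` to `g η`. -/
@[ext]
structure Q (L : LadderSystem) (F : (ℕ → Fin 2) →. Fin 2) (g : Omega → Fin 2) where
  δ : Ordinal.{0}
  δ_lt : δ < ω₁
  toFun : Set.Iio δ → Fin 2
  coded : ∀ (η : Omega) (h : (η : Ordinal) ≤ δ),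
    g η ∈ F (fun i => toFun ⟨nthElem (L.C η) i, (L.nthElem_lt η i).trans_le h⟩)

/-- `q ≤ p` (`q` is the stronger condition) iff the function `q` extends the function `p`. -/
instance (L : LadderSystem) (F : (ℕ → Fin 2) →. Fin 2) (g : Omega → Fin 2) :
    PartialOrder (Q L F g) where
  le q p := ∃ h : p.δ ≤ q.δ, ∀ α : Set.Iio p.δ, q.toFun ⟨α, α.2.trans_le h⟩ = p.toFun α
  le_refl p := ⟨le_rfl, fun _ => rfl⟩
  le_trans r q p := fun ⟨h₁, e₁⟩ ⟨h₂, e₂⟩ =>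
    ⟨h₂.trans h₁, fun α => (e₁ ⟨α, α.2.trans_le h₂⟩).trans (e₂ α)⟩
  le_antisymm p q := fun ⟨h₁, e₁⟩ ⟨h₂, _⟩ => by
    obtain ⟨δ, hδ, f, hf⟩ := p
    obtain ⟨δ', hδ', f', hf'⟩ := q
    obtain rfl : δ = δ' := le_antisymm h₂ h₁
    obtain rfl : f = f' := funext e₁
    rfl

/-! ### Dense sets and distributivity of a forcing notion (smaller conditions are stronger) -/

section Forcing

variable {P : Type u} [Preorder P]

/-- `D` is dense below `p`. -/
def DenseBelow (D : Set P) (p : P) : Prop := ∀ q ≤ p, ∃ d ∈ D, d ≤ q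

/-- `D` is dense in the forcing notion `P`. -/
def DenseIn (D : Set P) : Prop := ∀ q : P, ∃ d ∈ D, d ≤ q

/-- Two conditions are compatible if they have a common extension. -/
def Compat (p q : P) : Prop := ∃ r, r ≤ p ∧ r ≤ q

variable (P) in
/-- `P` is `(ω, ∞)`-distributive: the intersection of countably many dense open subsets is dense. -/
def OmegaDistributive : Prop :=
  ∀ D : ℕ → Set P, (∀ n, DenseIn (D n) ∧ IsLowerSet (D n)) → DenseIn (⋂ n, D n)

/-! ### Names for reals

Every subset of `ω × ω` in a forcing extension by `P` has a name of the form
`{((n, m)ˇ, a) : a ∈ A n m}` with `A n m ⊆ P`; the family `A` stands for this name. -/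

/-- `q ⊩ (n, m) ∈ Ȧ`. -/
def ForcesMem (A : ℕ → ℕ → Set P) (q : P) (n m : ℕ) : Prop :=
  DenseBelow {r | ∃ a ∈ A n m, r ≤ a} q

/-- `q ⊩ Ȧ ∈ ω^ω`: it is forced that for every `n` there is exactly one `m` with `(n, m) ∈ Ȧ`. -/
def ForcesReal (A : ℕ → ℕ → Set P) (q : P) : Prop :=
  ∀ n, DenseBelow {r | ∃ m, ForcesMem A r n m} q ∧
    ∀ r ≤ q, ∀ m m', ForcesMem A r n m → ForcesMem A r n m' → m = m'

variable (P) in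
/-- `P` adds no new reals: whenever a condition `q` forces `Ȧ ∈ ω^ω`, some `r ≤ q` and some ground
model `y ∈ ω^ω` are such that `r ⊩ Ȧ = y`. -/
def AddsNoNewReals : Prop :=
  ∀ (A : ℕ → ℕ → Set P) (q : P), ForcesReal A q →
    ∃ r ≤ q, ∃ y : ℕ → ℕ, ∀ n, ForcesMem A r n (y n)

end Forcing

/-! ### `H(θ)` and properness -/

/-- The only symbol of the language of set theory: a binary relation symbol. -/
inductive SetRel : ℕ → Type
  | mem : SetRel 2

/-- The first-order language `{∈}` of set theory. -/
def langSet : FirstOrder.Language.{0, 0} := ⟨fun _ => Empty, SetRel⟩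

/-- `H(θ)`: the sets whose transitive closure (least transitive superset) has cardinality `< θ`. -/
def H (θ : Cardinal.{u}) : Set ZFSet.{u} :=
  {x | ∃ t : ZFSet.{u}, t.IsTransitive ∧ x ⊆ t ∧ t.card < θ}

/-- `H(θ)` as the structure `(H(θ), ∈)`. -/
instance (θ : Cardinal.{u}) : langSet.Structure (H θ) where
  funMap f := f.elim
  RelMap | .mem => fun v => (v 0 : ZFSet) ∈ (v 1 : ZFSet)

section Proper

variable {P : Type u} [Preorder P]

/-- The underlying set of the copy of `P` among the sets given by an injection `e`. -/
noncomputable def carrierSet (e : P ↪ ZFSet.{u}) : ZFSet.{u} := ZFSet.range e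

/-- The order, as a set of ordered pairs, of the copy of `P` given by an injection `e`. -/
noncomputable def leSet (e : P ↪ ZFSet.{u}) : ZFSet.{u} :=
  ZFSet.range fun z : {z : P × P // z.1 ≤ z.2} => ZFSet.pair (e z.1.1) (e z.1.2)

/-- `q` is `(X, P)`-generic: for every dense `D ⊆ P` with `D ∈ X`, the set `D ∩ X` is predense
below `q`. -/
def IsGenericCond (e : P ↪ ZFSet.{u}) (X : Set ZFSet.{u}) (q : P) : Prop :=
  ∀ D ∈ X, D ⊆ carrierSet e → DenseIn {p | e p ∈ D} →
    ∀ r ≤ q, ∃ d : P, e d ∈ D ∧ e d ∈ X ∧ Compat d r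

variable (P) in
/-- `P` is proper: for every regular uncountable `θ > 2^|P|` with `P ∈ H(θ)`, every countable
`X ≺ (H(θ), ∈)` with `P, ≤ ∈ X` and every `p ∈ P ∩ X` there is an `(X, P)`-generic `q ≤ p`.
Here `P` is regarded as a set by means of an arbitrary injection `e` of `P` into the universe
of sets. -/
def IsProper : Prop :=
  ∀ (e : P ↪ ZFSet.{u}) (θ : Cardinal.{u}), θ.IsRegular → ℵ₀ < θ → 2 ^ #P < θ →
    carrierSet e ∈ H θ →
    ∀ X : langSet.ElementarySubstructure (H θ),
      let X' : Set ZFSet.{u} := Subtype.val '' (X : Set (H θ))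
      X'.Countable → carrierSet e ∈ X' → leSet e ∈ X' →
        ∀ p : P, e p ∈ X' → ∃ q ≤ p, IsGenericCond e X' q

end Proper

end LadderForcing

/-!
Fix countably many dense sets and a countable set `Y` of conditions, and let `η` be the supremum
of the lengths of the conditions in `Y`. One wants a descending sequence in `Y` that meets all the
dense sets and whose union `q` has length `η`, so that `q` has to take along the ladder at `η` the
values of a point `x` with `F x = g η`, fixed in advance. The danger is that meeting a dense set
takes the condition past new ladder points, with wrong values. It is averted by reservoirs:
countable sets of conditions of length less than some `γ < η` inside which finitely many values
can be prescribed and the dense set can be met. The ladder at `η` has only finitely many points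
below `γ`; extend the condition inside the reservoir past all of these, with the values given by
`x`, and only then meet the dense set inside the reservoir.

For distributivity, `Y` is the closure of a condition under a choice of reservoirs. For
properness, `Y` is the set of conditions in `X`, and elementarity has to yield a reservoir in `X`
for each dense set in `X`. The length of a condition need not be visible in `H(θ)`, where
conditions are arbitrary sets, but the comparison of lengths is the comparison of ranks in the
order, which is a definable relation. A countable set in `X` is a subset of `X`, since `X`
contains a function and a point whose orbit covers it.
-/

namespace LadderForcing

open Ordinal Cardinal

/-! ### Ladders, conditions and flexible sets -/

namespace LadderSystem

variable (L : LadderSystem) (η : Omega)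

theorem nthElem_strictMono : StrictMono (nthElem (L.C η)) := by
  intro i j hij
  by_contra! h
  have hcard : (j : ℕ∞) ≤ i := by
    rw [← (nthElem_spec (L.orderType η) i).2, ← (nthElem_spec (L.orderType η) j).2]
    exact Set.encard_le_encard (Set.inter_subset_inter_right _ (Set.Iio_subset_Iio h))
  exact absurd (by exact_mod_cast hcard) (not_le.2 hij)

theorem finite_inter_Iio {β : Ordinal} (hβ : β ∈ L.C η) : (L.C η ∩ Set.Iio β).Finite := by
  obtain ⟨e⟩ := L.orderType η
  refine ((Set.finite_Iio (e.symm ⟨β, hβ⟩)).image fun k => (e k : Ordinal)).subset ?_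
  rintro x ⟨hx, hlt⟩
  exact ⟨e.symm ⟨x, hx⟩, e.symm.lt_iff_lt.2 (Subtype.mk_lt_mk.2 hlt), by simp⟩

theorem exists_le_nthElem {α : Ordinal} (hα : α < η) : ∃ n, α ≤ nthElem (L.C η) n := by
  obtain ⟨β, hβ, hαβ⟩ := L.cofinal η α hα
  by_contra! h
  have hsub : Set.range (nthElem (L.C η)) ⊆ L.C η ∩ Set.Iio β := by
    rintro _ ⟨n, rfl⟩
    exact ⟨(nthElem_spec (L.orderType η) n).1, (h n).trans_le hαβ⟩
  exact Set.infinite_range_of_injective (L.nthElem_strictMono η).injective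
    ((L.finite_inter_Iio η hβ).subset hsub)

theorem exists_forall_nthElem_lt_iff {α : Ordinal} (hα : α < η) :
    ∃ n, ∀ i, nthElem (L.C η) i < α ↔ i < n := by
  classical
  have h := L.exists_le_nthElem η hα
  refine ⟨Nat.find h, fun i => ⟨fun hi => ?_, fun hi => not_le.1 (Nat.find_min h hi)⟩⟩
  by_contra! hn
  exact absurd hi (not_lt.2 ((Nat.find_spec h).trans ((L.nthElem_strictMono η).monotone hn)))

end LadderSystem

namespace Q

variable {L : LadderSystem} {F : (ℕ → Fin 2) →. Fin 2} {g : Omega → Fin 2}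

open Classical in
/-- The value of a condition at `α`. It is `0` outside the domain of the condition, so that
conditions can be handled as total functions. -/
noncomputable def val (p : Q L F g) (α : Ordinal.{0}) : Fin 2 :=
  if h : α < p.δ then p.toFun ⟨α, h⟩ else 0

theorem val_of_lt (p : Q L F g) {α : Ordinal} (h : α < p.δ) : p.val α = p.toFun ⟨α, h⟩ :=
  dif_pos h

theorem le_iff {q p : Q L F g} : q ≤ p ↔ p.δ ≤ q.δ ∧ ∀ α < p.δ, q.val α = p.val α := by
  constructor
  · rintro ⟨h, e⟩
    refine ⟨h, fun α hα => ?_⟩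
    rw [val_of_lt _ hα, val_of_lt _ (hα.trans_le h)]
    exact e ⟨α, hα⟩
  · rintro ⟨h, e⟩
    refine ⟨h, fun α => ?_⟩
    have := e α α.2
    rwa [val_of_lt _ α.2, val_of_lt _ (lt_of_lt_of_le α.2 h)] at this

theorem δ_antitone : Antitone (δ : Q L F g → Ordinal) := fun _ _ h => (le_iff.1 h).1

theorem val_eq_of_le {q p : Q L F g} (h : q ≤ p) {α : Ordinal} (hα : α < p.δ) :
    q.val α = p.val α :=
  (le_iff.1 h).2 α hα

theorem ext_val {p q : Q L F g} (hδ : p.δ = q.δ) (h : ∀ α < p.δ, p.val α = q.val α) : p = q :=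
  le_antisymm (le_iff.2 ⟨hδ.ge, fun α hα => h α (hα.trans_eq hδ.symm)⟩)
    (le_iff.2 ⟨hδ.le, fun α hα => (h α hα).symm⟩)

theorem lt_iff {q p : Q L F g} : q < p ↔ q ≤ p ∧ p.δ < q.δ := by
  refine ⟨fun h => ⟨h.le, lt_of_le_of_ne (δ_antitone h.le) fun e => h.ne ?_⟩, fun h => ?_⟩
  · exact ext_val e.symm fun α hα => val_eq_of_le h.le (hα.trans_eq e.symm)
  · exact lt_of_le_of_ne h.1 fun e => h.2.ne (e ▸ rfl)

theorem δ_strictAnti : StrictAnti (δ : Q L F g → Ordinal) := fun _ _ h => (lt_iff.1 h).2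

instance : WellFoundedGT (Q L F g) := δ_strictAnti.wellFoundedGT

theorem coded_val (p : Q L F g) (η : Omega) (h : (η : Ordinal) ≤ p.δ) :
    g η ∈ F fun i => p.val (nthElem (L.C η) i) := by
  convert p.coded η h using 2
  funext i
  exact val_of_lt _ _

/-- The condition with domain `δ` given by a total function. -/
def ofFun (δ : Ordinal.{0}) (hδ : δ < ω₁) (f : Ordinal.{0} → Fin 2)
    (h : ∀ η : Omega, (η : Ordinal) ≤ δ → g η ∈ F fun i => f (nthElem (L.C η) i)) : Q L F g where
  δ := δ
  δ_lt := hδ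
  toFun α := f α
  coded := h

theorem val_ofFun {δ : Ordinal.{0}} {hδ : δ < ω₁} {f : Ordinal.{0} → Fin 2}
    {h : ∀ η : Omega, (η : Ordinal) ≤ δ → g η ∈ F fun i => f (nthElem (L.C η) i)}
    {α : Ordinal} (hα : α < δ) : (ofFun δ hδ f h : Q L F g).val α = f α :=
  val_of_lt _ hα

/-- The restriction of a condition to an initial segment `β` of its domain. -/
noncomputable def restrict (p : Q L F g) (β : Ordinal.{0}) (hβ : β ≤ p.δ) : Q L F g :=
  ofFun β (hβ.trans_lt p.δ_lt) p.val fun η h => p.coded_val η (h.trans hβ)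

theorem val_restrict (p : Q L F g) {α β : Ordinal} (hβ : β ≤ p.δ) (hα : α < β) :
    (p.restrict β hβ).val α = p.val α :=
  val_ofFun hα

theorem le_restrict (p : Q L F g) {β : Ordinal} (hβ : β ≤ p.δ) : p ≤ p.restrict β hβ :=
  le_iff.2 ⟨hβ, fun _ hα => (p.val_restrict hβ hα).symm⟩

theorem lt_restrict (p : Q L F g) {β : Ordinal} (hβ : β < p.δ) : p < p.restrict β hβ.le :=
  lt_iff.2 ⟨p.le_restrict hβ.le, hβ⟩

open Classical in
/-- The extension of a condition by one further value. -/
noncomputable def snoc (p : Q L F g) (i : Fin 2) : Q L F g :=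
  ofFun (Order.succ p.δ) ((isSuccLimit_omega 1).succ_lt p.δ_lt)
    (fun α => if α < p.δ then p.val α else i) fun η h => by
      have h' := η.2.1.le_succ_iff.1 h
      convert p.coded_val η h' using 2
      funext k
      exact if_pos ((L.nthElem_lt η k).trans_le h')

theorem snoc_δ (p : Q L F g) (i : Fin 2) : (p.snoc i).δ = Order.succ p.δ := rfl

theorem snoc_le (p : Q L F g) (i : Fin 2) : p.snoc i ≤ p :=
  le_iff.2 ⟨Order.le_succ _, fun α hα => by
    rw [snoc, val_ofFun (hα.trans (Order.lt_succ _)), if_pos hα]⟩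

theorem val_snoc_self (p : Q L F g) (i : Fin 2) : (p.snoc i).val p.δ = i := by
  rw [snoc, val_ofFun (Order.lt_succ _), if_neg (lt_irrefl _)]

theorem snoc_covBy (p : Q L F g) (i : Fin 2) : p.snoc i ⋖ p :=
  ⟨lt_iff.2 ⟨p.snoc_le i, Order.lt_succ _⟩, fun _ h₁ h₂ =>
    (δ_strictAnti h₂).not_ge (Order.lt_succ_iff.1 (δ_strictAnti h₁))⟩

theorem exists_eq_snoc_of_covBy {v p : Q L F g} (h : v ⋖ p) : ∃ i, v = p.snoc i := by
  have hδ : v.δ = Order.succ p.δ := by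
    refine le_antisymm (not_lt.1 fun hv => ?_) (Order.succ_le_of_lt (δ_strictAnti h.lt))
    have hlt : v.restrict (Order.succ p.δ) hv.le < p :=
      lt_iff.2 ⟨le_iff.2 ⟨Order.le_succ _, fun α hα => by
        rw [val_restrict _ _ (hα.trans (Order.lt_succ _)), val_eq_of_le h.le hα]⟩, Order.lt_succ _⟩
    exact h.2 (v.lt_restrict hv) hlt
  refine ⟨v.val p.δ, ext_val hδ fun α hα => ?_⟩
  rw [hδ, Order.lt_succ_iff] at hα
  rcases hα.lt_or_eq with hα | rfl
  · rw [val_eq_of_le h.le hα, val_eq_of_le (p.snoc_le _) hα]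
  · rw [val_snoc_self]

/-- The condition `p` agrees with `x` on the part of the ladder at `η` inside its domain. -/
def Agrees (η : Omega) (x : ℕ → Fin 2) (p : Q L F g) : Prop :=
  ∀ i, nthElem (L.C η) i < p.δ → p.val (nthElem (L.C η) i) = x i

theorem exists_agrees (hF : IsDenseFn F) (p : Q L F g) (η : Omega) (h : p.δ < η) :
    ∃ x, g η ∈ F x ∧ Agrees η x p := by
  obtain ⟨n, hn⟩ := L.exists_forall_nthElem_lt_iff η h
  have hval : g η ∈ F.image (cyl fun i : Fin n => p.val (nthElem (L.C η) i)) := by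
    rw [hF]
    exact Set.mem_univ _
  obtain ⟨x, hx, hgx⟩ := hval
  exact ⟨x, hgx, fun i hi => (hx ⟨i, (hn i).1 hi⟩).symm⟩

section Flexible

variable {η : Omega} {x : ℕ → Fin 2}

theorem Agrees.of_le {p q : Q L F g} (hp : Agrees η x p) (hqp : q ≤ p)
    (h : ∀ i, nthElem (L.C η) i < q.δ → nthElem (L.C η) i < p.δ) : Agrees η x q := fun i hi => by
  rw [val_eq_of_le hqp (h i hi), hp i (h i hi)]

/-- `S` is a set of conditions of length less than `γ` in which any value can be chosen at the next
place and any length below `γ` can be reached. In such a set finitely many values can be prescribed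
at will. The immediate extensions by one value are described as the covers in the order, to make
the notion definable from the order and the comparison of lengths. -/
structure IsFlexible (γ : Ordinal.{0}) (S : Set (Q L F g)) : Prop where
  length_lt : ∀ u ∈ S, u.δ < γ
  covBy_mem : ∀ u ∈ S, ∀ v, v ⋖ u → v ∈ S
  exists_le : ∀ u ∈ S, ∀ α, u.δ ≤ α → α < γ → ∃ v ∈ S, v ≤ u ∧ v.δ = α

variable {γ : Ordinal.{0}} {S : Set (Q L F g)}

theorem IsFlexible.infinite (hS : IsFlexible γ S) (hne : S.Nonempty) : S.Infinite := by
  intro hfin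
  obtain ⟨m, hm, hmin⟩ := hfin.exists_minimal hne
  have hcov := m.snoc_covBy 0
  exact hcov.lt.not_ge (hmin (hS.covBy_mem m hm _ hcov) hcov.le)

theorem IsFlexible.exists_agrees_step (hS : IsFlexible γ S) {n : ℕ} (hn : nthElem (L.C η) n < γ)
    {u : Q L F g} (hu : u ∈ S) (hux : Agrees η x u) (hlt : ∀ i < n, nthElem (L.C η) i < u.δ) :
    ∃ v ∈ S, v ≤ u ∧ Agrees η x v ∧ nthElem (L.C η) n < v.δ := by
  by_cases h : nthElem (L.C η) n < u.δ
  · exact ⟨u, hu, le_rfl, hux, h⟩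
  obtain ⟨v, hv, hvu, hvδ⟩ := hS.exists_le u hu _ (not_lt.1 h) hn
  have hwu := (v.snoc_le (x n)).trans hvu
  refine ⟨v.snoc (x n), hS.covBy_mem v hv _ (v.snoc_covBy _), hwu, fun i hi => ?_, ?_⟩
  · rw [snoc_δ, hvδ, Order.lt_succ_iff, (L.nthElem_strictMono η).le_iff_le] at hi
    rcases hi.lt_or_eq with hi | rfl
    · rw [val_eq_of_le hwu (hlt i hi), hux i (hlt i hi)]
    · rw [← hvδ, val_snoc_self]
  · rw [snoc_δ, hvδ]
    exact Order.lt_succ _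

theorem IsFlexible.exists_agrees (hS : IsFlexible γ S) {n : ℕ} (hn : nthElem (L.C η) n < γ)
    {u : Q L F g} (hu : u ∈ S) (hux : Agrees η x u) :
    ∃ v ∈ S, v ≤ u ∧ Agrees η x v ∧ nthElem (L.C η) n < v.δ := by
  have hmono := L.nthElem_strictMono η
  induction n with
  | zero => exact hS.exists_agrees_step hn hu hux (by simp)
  | succ n ih =>
    obtain ⟨v, hv, hvu, hvx, hlt⟩ := ih ((hmono n.lt_succ_self).trans hn)
    obtain ⟨w, hw, hwv, hwx, hn⟩ := hS.exists_agrees_step hn hv hvx fun i hi =>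
      (hmono.monotone (Nat.lt_succ_iff.1 hi)).trans_lt hlt
    exact ⟨w, hw, hwv.trans hvu, hwx, hn⟩

theorem IsFlexible.exists_agrees_forall (hS : IsFlexible γ S) (hγ : γ < η) {u : Q L F g}
    (hu : u ∈ S) (hux : Agrees η x u) :
    ∃ v ∈ S, v ≤ u ∧ Agrees η x v ∧ ∀ i, nthElem (L.C η) i < γ → nthElem (L.C η) i < v.δ := by
  obtain ⟨N, hN⟩ := L.exists_forall_nthElem_lt_iff η hγ
  cases N with
  | zero => exact ⟨u, hu, le_rfl, hux, fun i hi => absurd ((hN i).1 hi) i.not_lt_zero⟩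
  | succ N =>
    obtain ⟨v, hv, hvu, hvx, hlt⟩ := hS.exists_agrees ((hN N).2 N.lt_succ_self) hu hux
    exact ⟨v, hv, hvu, hvx, fun i hi =>
      ((L.nthElem_strictMono η).monotone (Nat.lt_succ_iff.1 ((hN i).1 hi))).trans_lt hlt⟩

theorem exists_le_of_agrees (hx : g η ∈ F x) {u : ℕ → Q L F g} (hu : Antitone u)
    (hlt : ∀ n, (u n).δ < η) (hux : ∀ n, Agrees η x (u n))
    (hcof : ∀ i, ∃ n, nthElem (L.C η) i < (u n).δ) : ∃ q : Q L F g, q.δ = η ∧ ∀ n, q ≤ u n := by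
  classical
  let f : Ordinal → Fin 2 := fun α => if h : ∃ n, α < (u n).δ then (u h.choose).val α else 0
  have hf : ∀ n, ∀ α < (u n).δ, f α = (u n).val α := fun n α hα => by
    have h : ∃ n, α < (u n).δ := ⟨n, hα⟩
    simp only [f, dif_pos h]
    rcases le_total n h.choose with hle | hle
    · exact val_eq_of_le (hu hle) hα
    · exact (val_eq_of_le (hu hle) h.choose_spec).symm
  refine ⟨ofFun η η.2.2 f fun ζ hζ => ?_, rfl, fun n => le_iff.2 ⟨(hlt n).le, fun α hα => ?_⟩⟩
  · rcases hζ.lt_or_eq with hζ | hζ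
    · obtain ⟨i, hi⟩ := L.exists_le_nthElem η hζ
      obtain ⟨n, hn⟩ := hcof i
      have hζn := hi.trans_lt hn
      convert (u n).coded_val ζ hζn.le using 2
      funext j
      exact hf n _ ((L.nthElem_lt ζ j).trans hζn)
    · obtain rfl : ζ = η := Subtype.ext hζ
      convert hx using 2
      funext i
      obtain ⟨n, hn⟩ := hcof i
      rw [hf n _ hn, hux n i hn]
  · rw [val_ofFun (hα.trans (hlt n)), hf n α hα]

theorem exists_le_forall_exists_mem (hx : g η ∈ F x) {W : Set (Q L F g)}
    (hW : ∀ u ∈ W, u.δ < η ∧ Agrees η x u) {E : ℕ → Set (Q L F g)}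
    (hE : ∀ n, ∀ u ∈ W, ∃ v ∈ W, v ≤ u ∧ nthElem (L.C η) n < v.δ ∧ v ∈ E n)
    {p : Q L F g} (hp : p ∈ W) : ∃ q ≤ p, q.δ = η ∧ ∀ n, ∃ u ∈ E n, q ≤ u := by
  choose! v hvW hvle hvn hvE using hE
  let u : ℕ → Q L F g := fun n => Nat.rec p v n
  have hu : ∀ n, u n ∈ W := fun n => by
    induction n with
    | zero => exact hp
    | succ n ih => exact hvW n _ ih
  obtain ⟨q, hqδ, hq⟩ := exists_le_of_agrees hx (u := u)
    (antitone_nat_of_succ_le fun n => hvle n _ (hu n)) (fun n => (hW _ (hu n)).1)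
    (fun n => (hW _ (hu n)).2) fun i => ⟨i + 1, hvn i _ (hu i)⟩
  exact ⟨q, hq 0, hqδ, fun n => ⟨u (n + 1), hvE n _ (hu n), hq (n + 1)⟩⟩

end Flexible

theorem exists_le_length_eq (hF : IsDenseFn F) (p : Q L F g) {β : Ordinal} (hβ : p.δ ≤ β)
    (hβ' : β < ω₁) : ∃ q ≤ p, q.δ = β := by
  induction β using SuccOrder.limitRecOn generalizing p with
  | isMin β hmin => exact ⟨p, le_rfl, le_antisymm hβ (hmin.isBot _)⟩
  | succ β _ ih =>
    rcases hβ.lt_or_eq with hβ | hβ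
    · obtain ⟨q, hq, hqδ⟩ := ih p (Order.lt_succ_iff.1 hβ) ((Order.lt_succ _).trans hβ')
      exact ⟨q.snoc 0, (q.snoc_le 0).trans hq, by rw [snoc_δ, hqδ]⟩
    · exact ⟨p, le_rfl, hβ⟩
  | isSuccLimit β hlim ih =>
    rcases hβ.lt_or_eq with hβ | hβ
    · let η : Omega := ⟨β, hlim, hβ'⟩
      obtain ⟨x, hx, hpx⟩ := exists_agrees hF p η hβ
      have hflex : IsFlexible β {u : Q L F g | u.δ < β} :=
        { length_lt := fun _ hu => hu
          covBy_mem := fun u hu v huv => by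
            obtain ⟨i, rfl⟩ := exists_eq_snoc_of_covBy huv
            exact hlim.succ_lt hu
          exists_le := fun u _ α huα hα => by
            obtain ⟨v, hv, hvδ⟩ := ih α hα u huα (hα.trans hβ')
            exact ⟨v, hvδ.trans_lt hα, hv, hvδ⟩ }
      obtain ⟨q, hq, hqδ, -⟩ := exists_le_forall_exists_mem (η := η) hx
        (W := {u | u.δ < β ∧ Agrees η x u}) (fun _ hu => hu) (E := fun _ => Set.univ)
        (fun n u hu => by
          obtain ⟨v, hv, hvu, hvx, hn⟩ := hflex.exists_agrees (L.nthElem_lt η n) hu.1 hu.2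
          exact ⟨v, ⟨hv, hvx⟩, hvu, hn, Set.mem_univ v⟩) ⟨hβ, hpx⟩
      exact ⟨q, hq, hqδ⟩
    · exact ⟨p, le_rfl, hβ⟩

end Q

/-! ### Reservoirs and distributivity -/

theorem exists_countable_closed {α : Type*} (op : α → α → Set α) (hop : ∀ a b, (op a b).Countable)
    {T : Set α} (hT : T.Countable) :
    ∃ S : Set α, S.Countable ∧ T ⊆ S ∧ ∀ a ∈ S, ∀ b ∈ S, op a b ⊆ S := by
  let step : Set α → Set α := fun A => A ∪ ⋃ a ∈ A, ⋃ b ∈ A, op a b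
  let A : ℕ → Set α := fun n => step^[n] T
  have hsucc : ∀ n, A (n + 1) = step (A n) := fun n => Function.iterate_succ_apply' step n T
  have hmono : Monotone A := monotone_nat_of_le_succ fun n => by
    rw [hsucc]
    exact Set.subset_union_left
  have hcount : ∀ n, (A n).Countable := fun n => by
    induction n with
    | zero => exact hT
    | succ n ih =>
      rw [hsucc]
      exact ih.union (ih.biUnion fun a _ => ih.biUnion fun b _ => hop a b)
  refine ⟨⋃ n, A n, Set.countable_iUnion hcount, Set.subset_iUnion A 0, fun a ha b hb => ?_⟩
  obtain ⟨m, hm⟩ := Set.mem_iUnion.1 ha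
  obtain ⟨n, hn⟩ := Set.mem_iUnion.1 hb
  have hop_subset : op a b ⊆ A (max m n + 1) := fun x hx => by
    rw [hsucc]
    exact Or.inr (Set.mem_biUnion (hmono (le_max_left m n) hm)
      (Set.mem_biUnion (hmono (le_max_right m n) hn) hx))
  exact hop_subset.trans (Set.subset_iUnion A _)

namespace Q

variable {L : LadderSystem} {F : (ℕ → Fin 2) →. Fin 2} {g : Omega → Fin 2}

/-- A reservoir for `D` of height `γ`: a flexible set of conditions of length less than `γ` each of
which has an extension in `D` that is still in the set. -/
structure IsReservoir (D : Set (Q L F g)) (γ : Ordinal.{0}) (S : Set (Q L F g)) : Prop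
    extends IsFlexible γ S where
  dense : ∀ u ∈ S, ∃ d ∈ S, d ∈ D ∧ d ≤ u

theorem countable_Iic_δ (p : Q L F g) : (Set.Iic p.δ).Countable := by
  have h := (isSuccLimit_omega 1).succ_lt p.δ_lt
  rw [← ord_aleph, lt_ord, ← succ_aleph0, Order.lt_succ_iff] at h
  rwa [← Set.Iio_succ_eq_Iic, ← Set.countable_coe_iff, ← Cardinal.mk_le_aleph0_iff,
    Cardinal.mk_Iio_ordinal, Cardinal.lift_le_aleph0]

theorem exists_strict_lub_length {S : Set (Q L F g)} (hS : S.Countable) :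
    ∃ γ < ω₁, (∀ s ∈ S, s.δ < γ) ∧ ∀ α < γ, ∃ s ∈ S, α ≤ s.δ := by
  have := hS.to_subtype
  refine ⟨⨆ s : S, Order.succ s.1.δ,
    Ordinal.iSup_lt_omega_one fun s => (isSuccLimit_omega 1).succ_lt s.1.δ_lt,
    fun s hs => (Order.lt_succ s.δ).trans_le
      (Ordinal.le_iSup (fun s : S => Order.succ s.1.δ) ⟨s, hs⟩), fun α hα => ?_⟩
  obtain ⟨s, hs⟩ := Ordinal.lt_iSup_iff.1 hα
  exact ⟨s, s.2, Order.lt_succ_iff.1 hs⟩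

theorem exists_omega_lub_length {Y : Set (Q L F g)} (hY : Y.Countable) (hne : Y.Nonempty)
    (hmax : ∀ u ∈ Y, ∃ v ∈ Y, u.δ < v.δ) :
    ∃ η : Omega, (∀ u ∈ Y, u.δ < η) ∧ ∀ α < (η : Ordinal), ∃ u ∈ Y, α < u.δ := by
  obtain ⟨β, hβ, hlt, hle⟩ := exists_strict_lub_length hY
  have hex : ∀ α < β, ∃ u ∈ Y, α < u.δ := fun α hα => by
    obtain ⟨u, hu, hαu⟩ := hle α hα
    obtain ⟨v, hv, huv⟩ := hmax u hu
    exact ⟨v, hv, hαu.trans_lt huv⟩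
  have hlim : Order.IsSuccLimit β := by
    obtain ⟨u, hu⟩ := hne
    rw [Ordinal.isSuccLimit_iff, Order.isSuccPrelimit_iff_succ_lt]
    refine ⟨(zero_le.trans_lt (hlt u hu)).ne', fun α hα => ?_⟩
    obtain ⟨v, hv, hαv⟩ := hex α hα
    exact (Order.succ_le_of_lt hαv).trans_lt (hlt v hv)
  exact ⟨⟨β, hlim, hβ⟩, hlt, hex⟩

theorem exists_countable_isReservoir (hF : IsDenseFn F) {D : Set (Q L F g)} (hD : DenseIn D)
    (u b : Q L F g) : ∃ S : Set (Q L F g), ∃ c : Q L F g,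
      S.Countable ∧ u ∈ S ∧ b.δ ≤ c.δ ∧ IsReservoir D c.δ S := by
  choose d hdD hd using hD
  choose! ext hext using fun (u : Q L F g) (α : Ordinal) (h : u.δ ≤ α) (h' : α < ω₁) =>
    exists_le_length_eq hF u h h'
  obtain ⟨S, hSc, hubS, hS⟩ := exists_countable_closed
    (fun u b => insert (d u) (Set.range u.snoc ∪ ext u '' Set.Iic b.δ))
    (fun u b => ((Set.countable_range _).union (b.countable_Iic_δ.image _)).insert _)
    (Set.to_countable {u, b})
  obtain ⟨γ, hγ, hSγ, hγS⟩ := exists_strict_lub_length hSc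
  have hu : u ∈ S := hubS (by simp)
  obtain ⟨c, -, rfl⟩ : ∃ c ≤ u, c.δ = γ := exists_le_length_eq hF u (hSγ u hu).le hγ
  refine ⟨S, c, hSc, hu, (hSγ b (hubS (by simp))).le, ⟨⟨hSγ, fun u hu v huv => ?_,
    fun u hu α huα hα => ?_⟩, fun u hu => ⟨d u, hS u hu u hu (Or.inl rfl), hdD u, hd u⟩⟩⟩
  · obtain ⟨i, rfl⟩ := exists_eq_snoc_of_covBy huv
    exact hS u hu u hu (Or.inr (Or.inl ⟨i, rfl⟩))
  · obtain ⟨s, hs, hαs⟩ := hγS α hα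
    exact ⟨ext u α, hS u hu s hs (Or.inr (Or.inr ⟨α, hαs, rfl⟩)), hext u α huα (hα.trans hγ)⟩

-- Once `v` is beyond all the ladder points below the height of the reservoir, any extension of `v`
-- inside the reservoir agrees with `x`; so the dense set can be met there without further care.
theorem IsReservoir.exists_agrees_mem {η : Omega} {x : ℕ → Fin 2} {D : Set (Q L F g)}
    {γ : Ordinal} {S : Set (Q L F g)} (hS : IsReservoir D γ S) (hγ : γ < η) {u : Q L F g}
    (hu : u ∈ S) (hux : Agrees η x u) :
    ∃ d ∈ S, d ∈ D ∧ d ≤ u ∧ Agrees η x d ∧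
      ∀ i, nthElem (L.C η) i < γ → nthElem (L.C η) i < d.δ := by
  obtain ⟨v, hv, hvu, hvx, hvγ⟩ := hS.exists_agrees_forall hγ hu hux
  obtain ⟨d, hd, hdD, hdv⟩ := hS.dense v hv
  exact ⟨d, hd, hdD, hdv.trans hvu, hvx.of_le hdv fun i hi => hvγ i (hi.trans (hS.length_lt d hd)),
    fun i hi => (hvγ i hi).trans_le (δ_antitone hdv)⟩

theorem exists_le_forall_exists_mem_of_isReservoir (hF : IsDenseFn F) {Y : Set (Q L F g)}
    (hY : Y.Countable) {D : ℕ → Set (Q L F g)}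
    (hres : ∀ n, ∀ u ∈ Y, ∀ b ∈ Y, ∃ S ⊆ Y, ∃ c ∈ Y, u ∈ S ∧ b.δ ≤ c.δ ∧ IsReservoir (D n) c.δ S)
    {p : Q L F g} (hp : p ∈ Y) : ∃ q ≤ p, ∀ n, ∃ d ∈ Y, d ∈ D n ∧ q ≤ d := by
  obtain ⟨η, hlt, hex⟩ := exists_omega_lub_length hY ⟨p, hp⟩ fun u hu => by
    obtain ⟨S, -, c, hc, huS, -, hS⟩ := hres 0 u hu u hu
    exact ⟨c, hc, hS.length_lt u huS⟩
  obtain ⟨x, hx, hpx⟩ := exists_agrees hF p η (hlt p hp)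
  obtain ⟨q, hq, -, hqE⟩ := exists_le_forall_exists_mem hx
    (W := {u ∈ Y | Agrees η x u}) (fun u hu => ⟨hlt u hu.1, hu.2⟩) (E := fun n => Y ∩ D n)
    (fun n u ⟨hu, hux⟩ => by
      obtain ⟨b, hb, hbn⟩ := hex _ (L.nthElem_lt η n)
      obtain ⟨S, hSY, c, hc, huS, hbc, hS⟩ := hres n u hu b hb
      obtain ⟨d, hd, hdD, hdu, hdx, hdn⟩ := hS.exists_agrees_mem (hlt c hc) huS hux
      exact ⟨d, ⟨hSY hd, hdx⟩, hdu, hdn n (hbn.trans_le hbc), hSY hd, hdD⟩) ⟨hp, hpx⟩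
  refine ⟨q, hq, fun n => ?_⟩
  obtain ⟨d, ⟨hdY, hdD⟩, hqd⟩ := hqE n
  exact ⟨d, hdY, hdD, hqd⟩

end Q

section Distributivity

theorem omegaDistributive_Q {L : LadderSystem} {F : (ℕ → Fin 2) →. Fin 2} {g : Omega → Fin 2}
    (hF : IsDenseFn F) : OmegaDistributive (Q L F g) := by
  intro D hD p
  choose S c hSc huS hbc hS using fun n => Q.exists_countable_isReservoir hF (hD n).1
  obtain ⟨Y, hYc, hpY, hY⟩ := exists_countable_closed
    (fun u b => ⋃ n, insert (c n u b) (S n u b))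
    (fun u b => Set.countable_iUnion fun n => (hSc n u b).insert _) (Set.countable_singleton p)
  have hresY : ∀ n, ∀ u ∈ Y, ∀ b ∈ Y, insert (c n u b) (S n u b) ⊆ Y := fun n u hu b hb =>
    (Set.subset_iUnion _ n).trans (hY u hu b hb)
  obtain ⟨q, hq, hqD⟩ := Q.exists_le_forall_exists_mem_of_isReservoir hF hYc (D := D)
    (fun n u hu b hb => ⟨S n u b, (Set.subset_insert _ _).trans (hresY n u hu b hb), c n u b,
      hresY n u hu b hb (Set.mem_insert _ _), huS n u b, hbc n u b, hS n u b⟩) (hpY rfl)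
  refine ⟨q, Set.mem_iInter.2 fun n => ?_, hq⟩
  obtain ⟨d, -, hd, hqd⟩ := hqD n
  exact (hD n).2 hqd hd

variable {P : Type u} [Preorder P]

theorem ForcesMem.mono {A : ℕ → ℕ → Set P} {q r : P} {n m : ℕ} (h : ForcesMem A q n m)
    (hr : r ≤ q) : ForcesMem A r n m := fun s hs => h s (hs.trans hr)

theorem OmegaDistributive.addsNoNewReals (h : OmegaDistributive P) : AddsNoNewReals P := by
  intro A q hq
  let D : ℕ → Set P := fun n => {r | (∃ m, ForcesMem A r n m) ∨ ¬Compat r q}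
  have hD_dense : ∀ n, DenseIn (D n) := fun n r => by
    by_cases hc : Compat r q
    · obtain ⟨s, hsr, hsq⟩ := hc
      obtain ⟨d, hd, hds⟩ := (hq n).1 s hsq
      exact ⟨d, Or.inl hd, hds.trans hsr⟩
    · exact ⟨r, Or.inr hc, le_rfl⟩
  have hD_lower : ∀ n, IsLowerSet (D n) := fun n r s hsr hr => by
    rcases hr with ⟨m, hm⟩ | hr
    · exact Or.inl ⟨m, hm.mono hsr⟩
    · exact Or.inr fun ⟨t, ht, htq⟩ => hr ⟨t, ht.trans hsr, htq⟩
  obtain ⟨r, hr, hrq⟩ := h D (fun n => ⟨hD_dense n, hD_lower n⟩) q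
  have hdecided : ∀ n, ∃ m, ForcesMem A r n m := fun n =>
    (Set.mem_iInter.1 hr n).resolve_right fun hc => hc ⟨r, le_rfl, hrq⟩
  choose y hy using hdecided
  exact ⟨r, hrq, y, hy⟩

end Distributivity

/-! ### Definability of predicates on coded objects -/

section DefinableCoding

open FirstOrder

variable {L : Language} {M : Type*} [L.Structure M] {A : Set M}

theorem exists_mem_forall_mem_of_meetsDefinable (hA : L.MeetsDefinable A) {ι : Type*} [Finite ι]
    {D : Set (ι → M)} (hD : A.Definable L D) (hne : D.Nonempty) : ∃ v ∈ D, ∀ i, v i ∈ A := by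
  induction ι using Finite.induction_empty_option with
  | of_equiv f ih =>
    obtain ⟨_, ⟨v, hv, rfl⟩, hvA⟩ := ih (hD.image_comp_equiv f) (hne.image _)
    exact ⟨v, hv, fun i => by simpa using hvA (f.symm i)⟩
  | h_empty =>
    obtain ⟨v, hv⟩ := hne
    exact ⟨v, hv, fun i => i.elim⟩
  | h_option ih =>
    obtain ⟨_, ⟨v, hv, rfl⟩, hvA⟩ := ih (hD.image_comp some) (hne.image _)
    let fill : (Fin 1 → M) → Option _ → M := fun w i => i.elim (w 0) fun j => v (some j)
    have hfill : A.DefinableMap L fill := fun i => by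
      cases i with
      | none => exact Set.DefinableFun.proj L
      | some j => exact L.definableFun_const _ (hvA j)
    have hv' : fill (fun _ => v none) = v := by
      funext i
      cases i <;> rfl
    obtain ⟨a, ha, haA⟩ := hA {a | fill (fun _ => a) ∈ D} ⟨v none, by simpa [hv'] using hv⟩
      (hD.preimage_map hfill)
    refine ⟨_, ha, fun i => ?_⟩
    cases i with
    | none => exact haA
    | some j => exact hvA j

variable (L A) in
/-- A coding of the type `σ` by finite tuples of elements of the structure `M`, such that being a
code is definable with parameters in `A`. Through codings, first-order formulas over `M` can speak
about, and quantify over, objects that are not elements of `M`. Codes need not be unique. -/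
structure Coding (σ : Type*) where
  Index : Type
  [finite : Finite Index]
  code : σ → Index → M
  definable_range : A.Definable L (Set.range code)

namespace Coding

attribute [instance] Coding.finite

variable {σ τ υ : Type*} (c : Coding L A σ) (d : Coding L A τ)

/-- The objects all of whose coordinates lie in the set `A` of parameters. -/
def coded : Set σ := {x | ∀ i, c.code x i ∈ A}

/-- A predicate that can be expressed by a formula with parameters in `A` about the codes. -/
def Definable (φ : σ → Prop) : Prop :=
  ∃ D, A.Definable L D ∧ ∀ x, φ x ↔ c.code x ∈ D

/-- A map under which the code of the value is a definable function of the code of the argument. -/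
def DefinableMap (t : σ → τ) : Prop :=
  ∃ T, A.DefinableMap L T ∧ ∀ x, d.code (t x) = T (c.code x)

/-- The coding of pairs by concatenation of codes. -/
def prod : Coding L A (σ × τ) where
  Index := c.Index ⊕ d.Index
  code z := Sum.elim (c.code z.1) (d.code z.2)
  definable_range := by
    convert! (c.definable_range.preimage_comp Sum.inl).inter
      (d.definable_range.preimage_comp Sum.inr) using 1
    ext v
    constructor
    · rintro ⟨z, rfl⟩
      exact ⟨⟨z.1, rfl⟩, ⟨z.2, rfl⟩⟩
    · rintro ⟨⟨x, hx⟩, ⟨y, hy⟩⟩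
      exact ⟨(x, y), (congrArg₂ Sum.elim hx hy).trans (Sum.elim_comp_inl_inr v)⟩

/-- The coding of objects by single elements of `M`. -/
def single (f : σ → M) (hf : A.Definable₁ L (Set.range f)) : Coding L A σ where
  Index := Fin 1
  code x _ := f x
  definable_range := by
    suffices h : Set.range (fun x (_ : Fin 1) => f x) = {v | v 0 ∈ Set.range f} from h ▸ hf
    ext v
    constructor
    · rintro ⟨x, rfl⟩
      exact ⟨x, rfl⟩
    · rintro ⟨x, hx⟩
      exact ⟨x, funext fun i => hx.trans (congrArg v (Subsingleton.elim 0 i))⟩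

variable (L A) in
/-- The coding of the elements of `M` by themselves. -/
def self : Coding L A M :=
  single id (by simp [Set.Definable₁])

variable {c d}

theorem exists_mem_coded (hA : L.MeetsDefinable A) {φ : σ → Prop} (hφ : c.Definable φ)
    (hex : ∃ x, φ x) : ∃ x ∈ c.coded, φ x := by
  obtain ⟨D, hD, hφD⟩ := hφ
  obtain ⟨x, hx⟩ := hex
  obtain ⟨_, ⟨hyD, y, rfl⟩, hyA⟩ := exists_mem_forall_mem_of_meetsDefinable hA
    (hD.inter c.definable_range) ⟨c.code x, (hφD x).1 hx, x, rfl⟩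
  exact ⟨y, hyA, (hφD y).2 hyD⟩

theorem Definable.definable₁ {φ : M → Prop} (h : (self L A).Definable φ) :
    A.Definable₁ L {x | φ x} := by
  obtain ⟨D, hD, hφD⟩ := h
  have hset : {v : Fin 1 → M | φ (v 0)} = D := by
    ext v
    have hv : (self L A).code (v 0) = v :=
      funext fun i => congrArg v (Subsingleton.elim (0 : Fin 1) i)
    exact (hφD (v 0)).trans (by rw [hv]; rfl)
  exact show A.Definable L {v : Fin 1 → M | φ (v 0)} from hset ▸ hD

theorem prodMk_mem_coded {x : σ} {y : τ} :
    (x, y) ∈ (c.prod d).coded ↔ x ∈ c.coded ∧ y ∈ d.coded :=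
  Sum.forall

namespace DefinableMap

variable {e : Coding L A υ}

protected theorem id : c.DefinableMap c fun x => x :=
  ⟨fun v => v, fun _ => Set.DefinableFun.proj L, fun _ => rfl⟩

theorem const {y : τ} (hy : y ∈ d.coded) : c.DefinableMap d fun _ => y :=
  ⟨fun _ => d.code y, fun i => L.definableFun_const _ (hy i), fun _ => rfl⟩

theorem fst {t : υ → σ × τ} (h : e.DefinableMap (c.prod d) t) :
    e.DefinableMap c fun x => (t x).1 := by
  obtain ⟨T, hT, htT⟩ := h
  exact ⟨fun v => T v ∘ Sum.inl, fun i => hT (Sum.inl i), fun x => congrArg (· ∘ Sum.inl) (htT x)⟩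

theorem snd {t : υ → σ × τ} (h : e.DefinableMap (c.prod d) t) :
    e.DefinableMap d fun x => (t x).2 := by
  obtain ⟨T, hT, htT⟩ := h
  exact ⟨fun v => T v ∘ Sum.inr, fun i => hT (Sum.inr i), fun x => congrArg (· ∘ Sum.inr) (htT x)⟩

theorem prodMk {s : υ → σ} {t : υ → τ} (hs : e.DefinableMap c s) (ht : e.DefinableMap d t) :
    e.DefinableMap (c.prod d) fun x => (s x, t x) := by
  obtain ⟨S, hS, hsS⟩ := hs
  obtain ⟨T, hT, htT⟩ := ht
  refine ⟨fun v => Sum.elim (S v) (T v), fun i => ?_,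
    fun x => congrArg₂ Sum.elim (hsS x) (htT x)⟩
  cases i with
  | inl i => exact hS i
  | inr i => exact hT i

theorem comp {s : σ → τ} {t : υ → σ} (hs : c.DefinableMap d s) (ht : e.DefinableMap c t) :
    e.DefinableMap d fun x => s (t x) := by
  obtain ⟨S, hS, hsS⟩ := hs
  obtain ⟨T, hT, htT⟩ := ht
  exact ⟨S ∘ T, fun i => (hS i).comp hT, fun x => (hsS _).trans (congrArg S (htT x))⟩

theorem single {f : σ → M} (hf : A.Definable₁ L (Set.range f)) :
    (single f hf).DefinableMap (self L A) f :=
  ⟨fun v => v, fun _ => Set.DefinableFun.proj L, fun _ => rfl⟩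

end DefinableMap

namespace Definable

variable {φ ψ : σ → Prop}

theorem congr (h : c.Definable φ) (hiff : ∀ x, ψ x ↔ φ x) : c.Definable ψ := by
  obtain ⟨D, hD, hφD⟩ := h
  exact ⟨D, hD, fun x => (hiff x).trans (hφD x)⟩

theorem comp {φ : τ → Prop} (h : d.Definable φ) {t : σ → τ} (ht : c.DefinableMap d t) :
    c.Definable fun x => φ (t x) := by
  obtain ⟨D, hD, hφD⟩ := h
  obtain ⟨T, hT, htT⟩ := ht
  exact ⟨T ⁻¹' D, hD.preimage_map hT, fun x => (hφD (t x)).trans (by rw [htT]; rfl)⟩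

protected theorem not (h : c.Definable φ) : c.Definable fun x => ¬φ x := by
  obtain ⟨D, hD, hφD⟩ := h
  exact ⟨Dᶜ, hD.compl, fun x => not_congr (hφD x)⟩

protected theorem and (h : c.Definable φ) (h' : c.Definable ψ) :
    c.Definable fun x => φ x ∧ ψ x := by
  obtain ⟨D, hD, hφD⟩ := h
  obtain ⟨E, hE, hψE⟩ := h'
  exact ⟨D ∩ E, hD.inter hE, fun x => and_congr (hφD x) (hψE x)⟩

protected theorem imp (h : c.Definable φ) (h' : c.Definable ψ) : c.Definable fun x => φ x → ψ x :=
  (h.and h'.not).not.congr fun x => by tauto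

protected theorem or (h : c.Definable φ) (h' : c.Definable ψ) :
    c.Definable fun x => φ x ∨ ψ x :=
  (h.not.imp h').congr fun _ => or_iff_not_imp_left

protected theorem iff (h : c.Definable φ) (h' : c.Definable ψ) :
    c.Definable fun x => φ x ↔ ψ x :=
  ((h.imp h').and (h'.imp h)).congr fun _ => iff_iff_implies_and_implies

variable (d) in
protected theorem ex {χ : σ → τ → Prop} (h : (c.prod d).Definable fun z => χ z.1 z.2) :
    c.Definable fun x => ∃ y, χ x y := by
  obtain ⟨D, hD, hχD⟩ := h
  refine ⟨_, (hD.inter (d.definable_range.preimage_comp Sum.inr)).exists_of_finite, fun x => ?_⟩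
  constructor
  · rintro ⟨y, hy⟩
    exact ⟨d.code y, (hχD (x, y)).1 hy, y, rfl⟩
  · rintro ⟨v, hD, y, hy⟩
    obtain rfl : d.code y = v := hy
    exact ⟨y, (hχD (x, y)).2 hD⟩

variable (d) in
protected theorem all {χ : σ → τ → Prop} (h : (c.prod d).Definable fun z => χ z.1 z.2) :
    c.Definable fun x => ∀ y, χ x y :=
  (Definable.ex d h.not).not.congr fun _ => not_exists_not.symm

protected theorem eq (hd : Function.Injective d.code) {s t : σ → τ} (hs : c.DefinableMap d s)
    (ht : c.DefinableMap d t) : c.Definable fun x => s x = t x := by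
  obtain ⟨S, hS, hsS⟩ := hs
  obtain ⟨T, hT, htT⟩ := ht
  refine ⟨⋂ i, {v | S v i = T v i},
    Set.definable_iInter_of_finite fun i => (hS i).ofPred_eq (hT i), fun x => ?_⟩
  simp only [← hd.eq_iff, hsS, htT, funext_iff, Set.mem_iInter, Set.mem_ofPred_eq]

end Definable

theorem single_code_injective {f : σ → M} (hf : A.Definable₁ L (Set.range f))
    (hinj : Function.Injective f) : Function.Injective (single f hf).code := fun _ _ h =>
  hinj (congrFun h (0 : Fin 1))

theorem DefinableMap.of_graph {f : M → M → M}
    (h : (((self L A).prod (self L A)).prod (self L A)).Definable fun z => f z.1.1 z.1.2 = z.2) :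
    ((self L A).prod (self L A)).DefinableMap (self L A) fun z => f z.1 z.2 := by
  obtain ⟨D, hD, hfD⟩ := h
  refine ⟨fun v _ => f (v (Sum.inl (0 : Fin 1))) (v (Sum.inr (0 : Fin 1))), fun _ => ?_,
    fun _ => rfl⟩
  change A.Definable L (Function.tupleGraph _)
  convert! hD.preimage_comp (Sum.elim some fun _ => none) using 1
  ext w
  have hw : (((self L A).prod (self L A)).prod (self L A)).code
      ((w (some (Sum.inl (0 : Fin 1))), w (some (Sum.inr (0 : Fin 1)))), w none) =
      w ∘ Sum.elim some fun _ => none := by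
    funext i
    rcases i with (i | i) | i <;> obtain rfl := Subsingleton.elim (0 : Fin 1) i <;> rfl
  exact (hfD _).trans (iff_of_eq (congrArg (· ∈ D) hw))

end Coding

end DefinableCoding

/-! ### Codings by elements of `H(θ)` -/

section Hereditary

variable {θ : Cardinal.{u}}

theorem mem_H_of_mem {x y : ZFSet.{u}} (hy : y ∈ H θ) (h : x ∈ y) : x ∈ H θ := by
  obtain ⟨t, ht, hyt, hcard⟩ := hy
  exact ⟨t, ht, ht.subset_of_mem (hyt h), hcard⟩

theorem mem_H_of_subset {x y : ZFSet.{u}} (hy : y ∈ H θ) (h : x ⊆ y) : x ∈ H θ := by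
  obtain ⟨t, ht, hyt, hcard⟩ := hy
  exact ⟨t, ht, h.trans hyt, hcard⟩

theorem H_ext {x y : H θ} (h : ∀ z : H θ, (z : ZFSet) ∈ (x : ZFSet) ↔ (z : ZFSet) ∈ (y : ZFSet)) :
    x = y :=
  Subtype.ext <| ZFSet.ext fun z =>
    ⟨fun hz => (h ⟨z, mem_H_of_mem x.2 hz⟩).1 hz, fun hz => (h ⟨z, mem_H_of_mem y.2 hz⟩).2 hz⟩

theorem range_mem_H (hθ : θ.IsRegular) {ι : Type u} (hι : #ι < θ) {f : ι → ZFSet.{u}}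
    (hf : ∀ i, f i ∈ H θ) : ZFSet.range f ∈ H θ := by
  choose t ht hft hcard using hf
  refine ⟨ZFSet.range f ∪ ZFSet.iUnion t, ?_, ?_, ?_⟩
  · intro y hy z hz
    rw [ZFSet.mem_union] at hy ⊢
    refine Or.inr ?_
    rcases hy with hy | hy
    · obtain ⟨i, rfl⟩ := ZFSet.mem_range.1 hy
      exact ZFSet.mem_iUnion.2 ⟨i, hft i hz⟩
    · exact (ZFSet.IsTransitive.iUnion ht).mem_trans hz hy
  · exact fun y hy => ZFSet.mem_union.2 (Or.inl hy)
  · refine ZFSet.card_union_le.trans_lt (add_lt_of_lt hθ.aleph0_le ?_ ?_)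
    · have := ZFSet.lift_card_range_le (f := f)
      rw [Cardinal.lift_id, Cardinal.lift_id] at this
      exact this.trans_lt hι
    · have := ZFSet.lift_card_iUnion_le_sum_card (f := t)
      rw [Cardinal.lift_id] at this
      exact this.trans_lt (sum_lt_of_isRegular hθ hι hcard)

theorem unorderedPair_mem_H (hθ : θ.IsRegular) (x y : H θ) : ({↑x, ↑y} : ZFSet) ∈ H θ := by
  have h := range_mem_H hθ (ι := ULift Bool) (f := fun b => if b.down then (x : ZFSet) else y)
    ((lt_aleph0_of_finite _).trans_le hθ.aleph0_le) (by rintro ⟨_ | _⟩ <;> simp)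
  convert h
  ext z
  rw [ZFSet.mem_pair, ZFSet.mem_range]
  constructor
  · rintro (rfl | rfl)
    exacts [⟨⟨true⟩, rfl⟩, ⟨⟨false⟩, rfl⟩]
  · rintro ⟨⟨_ | _⟩, rfl⟩
    exacts [Or.inr rfl, Or.inl rfl]

/-- The unordered pair as an operation on `H(θ)`. -/
noncomputable def unorderedPairH (hθ : θ.IsRegular) (x y : H θ) : H θ :=
  ⟨{↑x, ↑y}, unorderedPair_mem_H hθ x y⟩

/-- The Kuratowski pair as an operation on `H(θ)`. -/
noncomputable def pairH (hθ : θ.IsRegular) (x y : H θ) : H θ :=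
  unorderedPairH hθ (unorderedPairH hθ x x) (unorderedPairH hθ x y)

@[simp]
theorem coe_pairH (hθ : θ.IsRegular) (x y : H θ) : (pairH hθ x y : ZFSet) = ZFSet.pair x y := by
  simp [pairH, unorderedPairH, ZFSet.pair]

theorem pair_mem_H (hθ : θ.IsRegular) {x y : ZFSet.{u}} (hx : x ∈ H θ) (hy : y ∈ H θ) :
    ZFSet.pair x y ∈ H θ :=
  coe_pairH hθ ⟨x, hx⟩ ⟨y, hy⟩ ▸ (pairH hθ ⟨x, hx⟩ ⟨y, hy⟩).2

end Hereditary

namespace Coding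

section SetTheory

variable {θ : Cardinal.{u}} {A : Set (H θ)} {σ : Type*} {c : Coding langSet A σ} {s t : σ → H θ}

theorem Definable.mem (hs : c.DefinableMap (self langSet A) s)
    (ht : c.DefinableMap (self langSet A) t) :
    c.Definable fun x => (s x : ZFSet) ∈ (t x : ZFSet) := by
  obtain ⟨S, hS, hsS⟩ := hs
  obtain ⟨T, hT, htT⟩ := ht
  let r : langSet.Relations 2 := SetRel.mem
  have hmem : A.Definable langSet {w : Fin 2 → H θ | (w 0 : ZFSet) ∈ (w 1 : ZFSet)} := by
    refine (Set.empty_definable_iff.2 ⟨r.formula₂ (.var 0) (.var 1), ?_⟩).mono (Set.empty_subset A)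
    ext w
    change _ ↔ (r.formula₂ (.var 0) (.var 1)).Realize w
    rw [FirstOrder.Language.Formula.realize_rel₂]
    rfl
  let F : (c.Index → H θ) → Fin 2 → H θ := fun v => ![S v (0 : Fin 1), T v (0 : Fin 1)]
  refine ⟨_, hmem.preimage_map (F := F) fun i => ?_, fun x => ?_⟩
  · fin_cases i
    exacts [hS _, hT _]
  · have hs := congrFun (hsS x) (0 : Fin 1)
    have ht := congrFun (htT x) (0 : Fin 1)
    exact show (s x : ZFSet) ∈ (t x : ZFSet) ↔ (S _ _ : ZFSet) ∈ (T _ _ : ZFSet) from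
      hs ▸ ht ▸ Iff.rfl

theorem DefinableMap.unorderedPairH (hθ : θ.IsRegular) (hs : c.DefinableMap (self langSet A) s)
    (ht : c.DefinableMap (self langSet A) t) :
    c.DefinableMap (self langSet A) fun x => unorderedPairH hθ (s x) (t x) := by
  have hinj : Function.Injective (self langSet A).code :=
    single_code_injective _ Function.injective_id
  refine DefinableMap.comp (.of_graph ?_) (hs.prodMk ht)
  refine Definable.congr (φ := fun z : (H θ × H θ) × H θ =>
    ∀ y : H θ, (y : ZFSet) ∈ (z.2 : ZFSet) ↔ y = z.1.1 ∨ y = z.1.2) ?_ fun z => ?_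
  · exact .all (self langSet A) ((Definable.mem (.snd .id) (.snd (.fst .id))).iff
      ((Definable.eq hinj (.snd .id) (.fst (.fst (.fst .id)))).or
        (.eq hinj (.snd .id) (.snd (.fst (.fst .id))))))
  · have hpair : ∀ y : H θ, (y : ZFSet) ∈ (LadderForcing.unorderedPairH hθ z.1.1 z.1.2 : ZFSet) ↔
        y = z.1.1 ∨ y = z.1.2 := fun y => by
      simp only [LadderForcing.unorderedPairH, ZFSet.mem_pair, Subtype.ext_iff]
    exact ⟨fun h => h ▸ hpair, fun h => H_ext fun y => (hpair y).trans (h y).symm⟩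

theorem DefinableMap.pairH (hθ : θ.IsRegular) (hs : c.DefinableMap (self langSet A) s)
    (ht : c.DefinableMap (self langSet A) t) :
    c.DefinableMap (self langSet A) fun x => pairH hθ (s x) (t x) :=
  .unorderedPairH hθ (.unorderedPairH hθ hs hs) (.unorderedPairH hθ hs ht)

end SetTheory

end Coding

section SetCoding

open Coding

variable {P : Type u}

/-- A binary relation on `P` as a set of ordered pairs of the copy of `P` given by `e`. -/
noncomputable def relSet (e : P ↪ ZFSet.{u}) (R : P → P → Prop) : ZFSet.{u} :=
  ZFSet.range fun z : {z : P × P // R z.1 z.2} => ZFSet.pair (e z.1.1) (e z.1.2)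

/-- A subset of `P` as a subset of the copy of `P` given by `e`. -/
noncomputable def subsetSet (e : P ↪ ZFSet.{u}) (S : Set P) : ZFSet.{u} :=
  ZFSet.range fun s : S => e s

variable {e : P ↪ ZFSet.{u}}

theorem pair_mem_relSet {R : P → P → Prop} {a b : P} :
    ZFSet.pair (e a) (e b) ∈ relSet e R ↔ R a b := by
  rw [relSet, ZFSet.mem_range]
  constructor
  · rintro ⟨⟨⟨a', b'⟩, h⟩, hz⟩
    obtain ⟨ha, hb⟩ := ZFSet.pair_injective hz
    rwa [← e.injective ha, ← e.injective hb]
  · exact fun h => ⟨⟨⟨a, b⟩, h⟩, rfl⟩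

theorem mem_subsetSet {S : Set P} {a : P} : e a ∈ subsetSet e S ↔ a ∈ S := by
  rw [subsetSet, ZFSet.mem_range]
  exact ⟨fun ⟨s, hs⟩ => e.injective hs ▸ s.2, fun h => ⟨⟨a, h⟩, rfl⟩⟩

theorem subsetSet_setOf {D : ZFSet.{u}} (hD : D ⊆ carrierSet e) :
    subsetSet e {p | e p ∈ D} = D := by
  ext z
  rw [subsetSet, ZFSet.mem_range]
  constructor
  · rintro ⟨⟨p, hp⟩, rfl⟩
    exact hp
  · intro hz
    obtain ⟨p, rfl⟩ := ZFSet.mem_range.1 (hD hz)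
    exact ⟨⟨p, hz⟩, rfl⟩

variable {θ : Cardinal.{u}} {A : Set (H θ)}

/-- The embedding of `P` into `H(θ)`. -/
def toH (he : carrierSet e ∈ H θ) (p : P) : H θ :=
  ⟨e p, mem_H_of_mem he (ZFSet.mem_range_self p)⟩

/-- The embedding of the power set of `P` into `H(θ)`. -/
noncomputable def setToH (he : carrierSet e ∈ H θ) (S : Set P) : H θ :=
  ⟨subsetSet e S, mem_H_of_subset he fun z hz => by
    obtain ⟨s, rfl⟩ := ZFSet.mem_range.1 hz
    exact ZFSet.mem_range_self _⟩

theorem relSet_mem_H (hθ : θ.IsRegular) (hP : #P < θ) (he : carrierSet e ∈ H θ)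
    (R : P → P → Prop) : relSet e R ∈ H θ := by
  refine range_mem_H hθ ?_ fun z => pair_mem_H hθ (toH he _).2 (toH he _).2
  refine (mk_subtype_le _).trans_lt ?_
  rw [mk_prod, Cardinal.lift_id]
  exact mul_lt_of_lt hθ.aleph0_le hP hP

/-- The embedding of the set of binary relations on `P` into `H(θ)`. -/
noncomputable def relToH (hθ : θ.IsRegular) (hP : #P < θ) (he : carrierSet e ∈ H θ)
    (R : P → P → Prop) : H θ :=
  ⟨relSet e R, relSet_mem_H hθ hP he R⟩

section

variable (he : carrierSet e ∈ H θ) (hA : (⟨carrierSet e, he⟩ : H θ) ∈ A)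

theorem toH_injective : Function.Injective (toH he) := fun _ _ h =>
  e.injective (congrArg Subtype.val h)

theorem mem_carrierSet_iff (y : H θ) : (y : ZFSet) ∈ carrierSet e ↔ ∃ p, toH he p = y := by
  simp only [carrierSet, ZFSet.mem_range, Subtype.ext_iff, toH]

include hA in
theorem definable₁_range_toH : A.Definable₁ langSet (Set.range (toH he)) :=
  Definable.definable₁ <| Definable.congr
    (Definable.mem .id (.const (y := (⟨carrierSet e, he⟩ : H θ)) fun _ => hA))
    fun y => (mem_carrierSet_iff he y).symm

/-- The coding of the elements of `P` by the elements of the copy of `P`. -/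
def elemCoding : Coding langSet A P :=
  single (toH he) (definable₁_range_toH he hA)

include hA in
theorem definable₁_range_setToH : A.Definable₁ langSet (Set.range (setToH he)) := by
  refine Definable.definable₁ <| Definable.congr (φ := fun y : H θ =>
    ∀ z : H θ, (z : ZFSet) ∈ (y : ZFSet) → (z : ZFSet) ∈ carrierSet e)
    (.all (self langSet A) ?_) fun y => ?_
  · exact .imp (.mem (.snd .id) (.fst .id))
      (.mem (.snd .id) (.const (y := (⟨carrierSet e, he⟩ : H θ)) fun _ => hA))
  · constructor
    · rintro ⟨S, rfl⟩ z hz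
      obtain ⟨s, hs⟩ := ZFSet.mem_range.1 hz
      exact (mem_carrierSet_iff he z).2 ⟨s, Subtype.ext hs⟩
    · exact fun h => ⟨{p | e p ∈ (y : ZFSet)},
        Subtype.ext (subsetSet_setOf fun z hz => h ⟨z, mem_H_of_mem y.2 hz⟩ hz)⟩

/-- The coding of the subsets of `P` by the subsets of the copy of `P`. -/
noncomputable def setCoding : Coding langSet A (Set P) :=
  single (setToH he) (definable₁_range_setToH he hA)

include hA in
theorem definable₁_range_relToH (hθ : θ.IsRegular) (hP : #P < θ) :
    A.Definable₁ langSet (Set.range (relToH hθ hP he)) := by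
  refine Definable.definable₁ <| Definable.congr (φ := fun y : H θ =>
    ∀ z : H θ, (z : ZFSet) ∈ (y : ZFSet) → ∃ a b, pairH hθ (toH he a) (toH he b) = z)
    (.all (self langSet A) ?_) fun y => ?_
  · have htoH := DefinableMap.single (definable₁_range_toH he hA)
    refine .imp (.mem (.snd .id) (.fst .id)) <| .ex (elemCoding he hA) <|
      .ex (elemCoding he hA) <| .eq (single_code_injective _ Function.injective_id)
      (.pairH hθ (htoH.comp (.snd (.fst .id))) (htoH.comp (.snd .id))) (.snd (.fst (.fst .id)))
  · constructor
    · rintro ⟨R, rfl⟩ z hz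
      obtain ⟨⟨⟨a, b⟩, _⟩, hab⟩ := ZFSet.mem_range.1 hz
      exact ⟨a, b, Subtype.ext ((coe_pairH hθ _ _).trans hab)⟩
    · intro h
      refine ⟨fun a b => ZFSet.pair (e a) (e b) ∈ (y : ZFSet), H_ext fun z => ⟨fun hz => ?_,
        fun hz => ?_⟩⟩
      · obtain ⟨⟨⟨a, b⟩, hab⟩, habz⟩ := ZFSet.mem_range.1 hz
        exact habz ▸ hab
      · obtain ⟨a, b, rfl⟩ := h z hz
        rw [coe_pairH] at hz ⊢
        exact (pair_mem_relSet (R := fun a b => ZFSet.pair (e a) (e b) ∈ (y : ZFSet))).2 hz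

/-- The coding of the binary relations on `P` by sets of pairs of elements of the copy of `P`. -/
noncomputable def relCoding (hθ : θ.IsRegular) (hP : #P < θ) : Coding langSet A (P → P → Prop) :=
  single (relToH hθ hP he) (definable₁_range_relToH he hA hθ hP)

end

variable {he : carrierSet e ∈ H θ} {hA : (⟨carrierSet e, he⟩ : H θ) ∈ A} {σ : Type*}
  {c : Coding langSet A σ} {s t : σ → P}

namespace Coding.Definable

theorem elem_eq (hs : c.DefinableMap (elemCoding he hA) s)
    (ht : c.DefinableMap (elemCoding he hA) t) : c.Definable fun x => s x = t x :=
  .eq (single_code_injective _ (toH_injective he)) hs ht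

theorem elem_mem {S : σ → Set P} (hs : c.DefinableMap (elemCoding he hA) s)
    (hS : c.DefinableMap (setCoding he hA) S) : c.Definable fun x => s x ∈ S x :=
  (Definable.mem ((DefinableMap.single _).comp hs) ((DefinableMap.single _).comp hS)).congr
    fun _ => mem_subsetSet.symm

theorem rel {hθ : θ.IsRegular} {hP : #P < θ} {R : σ → P → P → Prop}
    (hR : c.DefinableMap (relCoding he hA hθ hP) R) (hs : c.DefinableMap (elemCoding he hA) s)
    (ht : c.DefinableMap (elemCoding he hA) t) : c.Definable fun x => R x (s x) (t x) :=
  (Definable.mem (.pairH hθ ((DefinableMap.single _).comp hs) ((DefinableMap.single _).comp ht))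
    ((DefinableMap.single _).comp hR)).congr fun x => by
      rw [coe_pairH]
      exact pair_mem_relSet.symm

end Coding.Definable

end SetCoding

/-! ### Elementarity and properness -/

open Coding

section Elementarity

variable {P : Type u}

/-- `S` is contained in the orbit of `u` under the partial function with graph `f`. The existence of
`f` and `u` is a form of countability of `S` that can be expressed without speaking of numbers. -/
structure Enumerates (f : P → P → Prop) (u : P) (S : Set P) : Prop where
  functional : Relator.RightUnique f
  subset : ∀ Z : Set P, u ∈ Z → (∀ a ∈ Z, ∀ b, f a b → b ∈ Z) → S ⊆ Z

theorem exists_enumerates {S : Set P} (hS : S.Countable) (hinf : S.Infinite) :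
    ∃ f u, Enumerates f u S := by
  have := hS.to_subtype
  have := hinf.to_subtype
  obtain ⟨h⟩ : Nonempty (ℕ ≃ S) := nonempty_equiv_of_countable
  refine ⟨fun a b => ∃ n, a = h n ∧ b = h (n + 1), h 0, ?_, fun Z h0 hZ s hs => ?_⟩
  · rintro _ _ _ ⟨n, rfl, rfl⟩ ⟨m, hm, rfl⟩
    rw [h.injective (Subtype.ext hm)]
  · have hmem : ∀ n, (h n : P) ∈ Z := fun n => by
      induction n with
      | zero => exact h0
      | succ n ih => exact hZ _ ih _ ⟨n, rfl, rfl⟩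
    simpa using hmem (h.symm ⟨s, hs⟩)

/-- `R` compares the ranks of two elements in the converse of the order of `P`. -/
def IsRankLE [Preorder P] (R : P → P → Prop) : Prop :=
  ∀ a b, R a b ↔ ∀ a', a < a' → ∃ b', b < b' ∧ R a' b'

theorem IsRankLE.unique [Preorder P] [WellFoundedGT P] {R R' : P → P → Prop} (hR : IsRankLE R)
    (hR' : IsRankLE R') : R = R' := by
  funext a b
  refine propext ?_
  induction a using WellFoundedGT.induction generalizing b with
  | ind a ih =>
    rw [hR, hR']
    exact forall₂_congr fun a' ha' => exists_congr fun b' => and_congr_right fun _ => ih a' ha' b'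

variable {e : P ↪ ZFSet.{u}} {θ : Cardinal.{u}} {he : carrierSet e ∈ H θ} {A : Set (H θ)}
  {hA : (⟨carrierSet e, he⟩ : H θ) ∈ A} {hθ : θ.IsRegular} {hP : #P < θ}

theorem definable_enumerates :
    (((relCoding he hA hθ hP).prod (elemCoding he hA)).prod (setCoding he hA)).Definable
      fun z => Enumerates z.1.1 z.1.2 z.2 := by
  have hfun : (relCoding he hA hθ hP).Definable fun f =>
      ∀ a b b', f a b → f a b' → b = b' :=
    .all (elemCoding he hA) <| .all (elemCoding he hA) <| .all (elemCoding he hA) <|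
      .imp (.rel (.fst (.fst (.fst .id))) (.snd (.fst (.fst .id))) (.snd (.fst .id))) <|
        .imp (.rel (.fst (.fst (.fst .id))) (.snd (.fst (.fst .id))) (.snd .id)) <|
          .elem_eq (.snd (.fst .id)) (.snd .id)
  have hclosed : ((relCoding he hA hθ hP).prod (setCoding he hA)).Definable fun z =>
      ∀ a, a ∈ z.2 → ∀ b, z.1 a b → b ∈ z.2 :=
    .all (elemCoding he hA) <| .imp (.elem_mem (.snd .id) (.snd (.fst .id))) <|
      .all (elemCoding he hA) <|
        .imp (.rel (.fst (.fst (.fst .id))) (.snd (.fst .id)) (.snd .id)) <|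
          .elem_mem (.snd .id) (.snd (.fst (.fst .id)))
  have hsub : ((setCoding he hA).prod (setCoding he hA)).Definable fun z =>
      ∀ a, a ∈ z.1 → a ∈ z.2 :=
    .all (elemCoding he hA) <| .imp (.elem_mem (.snd .id) (.fst (.fst .id)))
      (.elem_mem (.snd .id) (.snd (.fst .id)))
  have horbit : (((relCoding he hA hθ hP).prod (elemCoding he hA)).prod
      (setCoding he hA)).Definable fun z => ∀ Z : Set P, z.1.2 ∈ Z →
        (∀ a, a ∈ Z → ∀ b, z.1.1 a b → b ∈ Z) → ∀ a, a ∈ z.2 → a ∈ Z :=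
    .all (setCoding he hA) <| .imp (.elem_mem (.snd (.fst (.fst .id))) (.snd .id)) <|
      .imp (hclosed.comp (.prodMk (.fst (.fst (.fst .id))) (.snd .id)))
        (hsub.comp (.prodMk (.snd (.fst .id)) (.snd .id)))
  exact ((hfun.comp (.fst (.fst .id))).and horbit).congr fun z =>
    ⟨fun h => ⟨fun a b b' => @h.functional a b b', h.subset⟩,
      fun h => ⟨fun a b b' => h.1 a b b', h.2⟩⟩

theorem subset_coded_of_enumerates (hX : langSet.MeetsDefinable A) (hθ : θ.IsRegular)
    (hP : #P < θ) {S : Set P} (hS : S ∈ (setCoding he hA).coded) (henum : ∃ f u, Enumerates f u S) :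
    S ⊆ (elemCoding he hA).coded := by
  obtain ⟨f, u, hfu⟩ := henum
  obtain ⟨⟨f, u⟩, hcoded, henum⟩ := exists_mem_coded hX
    ((definable_enumerates (hθ := hθ) (hP := hP)).comp (.prodMk .id (.const hS))) ⟨(f, u), hfu⟩
  obtain ⟨hf, hu⟩ := prodMk_mem_coded.1 hcoded
  refine henum.subset _ hu fun a ha b hab => ?_
  obtain ⟨b', hb', hab'⟩ := exists_mem_coded hX
    (Definable.rel (.const hf) (.const ha) (.id (c := elemCoding he hA))) ⟨b, hab⟩
  exact henum.functional hab hab' ▸ hb'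

variable [Preorder P] (hle : (fun a b : P => a ≤ b) ∈ (relCoding he hA hθ hP).coded)
  {σ : Type*} {c : Coding langSet A σ} {s t : σ → P}

namespace Coding.Definable

include hle

theorem le (hs : c.DefinableMap (elemCoding he hA) s) (ht : c.DefinableMap (elemCoding he hA) t) :
    c.Definable fun x => s x ≤ t x :=
  .rel (.const hle) hs ht

theorem lt (hs : c.DefinableMap (elemCoding he hA) s) (ht : c.DefinableMap (elemCoding he hA) t) :
    c.Definable fun x => s x < t x :=
  ((le hle hs ht).and (le hle ht hs).not).congr fun _ => lt_iff_le_not_ge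

theorem covBy (hs : c.DefinableMap (elemCoding he hA) s)
    (ht : c.DefinableMap (elemCoding he hA) t) : c.Definable fun x => s x ⋖ t x :=
  ((lt hle hs ht).and <| .all (elemCoding he hA) <| .imp (lt hle (hs.comp (.fst .id)) (.snd .id))
    (lt hle (.snd .id) (ht.comp (.fst .id))).not).congr fun _ => Iff.rfl

end Coding.Definable

include hle in
theorem mem_coded_of_isRankLE [WellFoundedGT P] (hX : langSet.MeetsDefinable A)
    {R : P → P → Prop} (hR : IsRankLE R) : R ∈ (relCoding he hA hθ hP).coded := by
  have hdef : (relCoding he hA hθ hP).Definable fun R => IsRankLE R :=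
    .all (elemCoding he hA) <| .all (elemCoding he hA) <|
      .iff (.rel (.fst (.fst .id)) (.snd (.fst .id)) (.snd .id)) <|
        .all (elemCoding he hA) <| .imp (.lt hle (.snd (.fst (.fst .id))) (.snd .id)) <|
          .ex (elemCoding he hA) <| .and (.lt hle (.snd (.fst (.fst .id))) (.snd .id))
            (.rel (.fst (.fst (.fst (.fst .id)))) (.snd (.fst .id)) (.snd .id))
  obtain ⟨R', hR'X, hR'⟩ := exists_mem_coded hX hdef ⟨R, hR⟩
  exact hR'.unique hR ▸ hR'X

end Elementarity

namespace Q

variable {L : LadderSystem} {F : (ℕ → Fin 2) →. Fin 2} {g : Omega → Fin 2}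

theorem isRankLE_length : IsRankLE fun a b : Q L F g => a.δ ≤ b.δ := by
  intro a b
  constructor
  · intro hab a' ha'
    have hlt := (δ_strictAnti ha').trans_le hab
    exact ⟨b.restrict a'.δ hlt.le, b.lt_restrict hlt, le_rfl⟩
  · intro h
    by_contra! hlt
    obtain ⟨b', hbb', hle⟩ := h _ (a.lt_restrict hlt)
    exact (δ_strictAnti hbb').not_ge hle

-- Every ordinal below `c.δ` is the length of a restriction of `c`, so that the quantification over
-- lengths can be replaced by one over conditions.
theorem isReservoir_iff {D S : Set (Q L F g)} {c : Q L F g} : IsReservoir D c.δ S ↔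
    (∀ u, u ∈ S → ¬c.δ ≤ u.δ) ∧ (∀ u, u ∈ S → ∀ v, v ⋖ u → v ∈ S) ∧
    (∀ u, u ∈ S → ∀ a : Q L F g, u.δ ≤ a.δ → ¬c.δ ≤ a.δ →
      ∃ v, v ∈ S ∧ v ≤ u ∧ v.δ ≤ a.δ ∧ a.δ ≤ v.δ) ∧
    ∀ u, u ∈ S → ∃ d, d ∈ S ∧ d ∈ D ∧ d ≤ u := by
  constructor
  · refine fun h => ⟨fun u hu => (h.length_lt u hu).not_ge, h.covBy_mem, fun u hu a hua hac => ?_,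
      h.dense⟩
    obtain ⟨v, hv, hvu, hva⟩ := h.exists_le u hu a.δ hua (not_le.1 hac)
    exact ⟨v, hv, hvu, hva.le, hva.ge⟩
  · rintro ⟨hlt, hcov, hext, hdense⟩
    refine ⟨⟨fun u hu => not_le.1 (hlt u hu), hcov, fun u hu α huα hα => ?_⟩, hdense⟩
    obtain ⟨v, hv, hvu, hvα, hαv⟩ := hext u hu (c.restrict α hα.le) huα hα.not_ge
    exact ⟨v, hv, hvu, hvα.antisymm hαv⟩

variable {e : Q L F g ↪ ZFSet.{1}} {θ : Cardinal.{1}} {he : carrierSet e ∈ H θ} {A : Set (H θ)}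
  {hA : (⟨carrierSet e, he⟩ : H θ) ∈ A} {hθ : θ.IsRegular} {hP : #(Q L F g) < θ}

theorem definable_length_le
    (hlen : (fun a b : Q L F g => a.δ ≤ b.δ) ∈ (relCoding he hA hθ hP).coded) {σ : Type*}
    {c : Coding langSet A σ} {s t : σ → Q L F g} (hs : c.DefinableMap (elemCoding he hA) s)
    (ht : c.DefinableMap (elemCoding he hA) t) : c.Definable fun x => (s x).δ ≤ (t x).δ :=
  .rel (R := fun _ a b => a.δ ≤ b.δ) (.const hlen) hs ht

theorem definable_isReservoir
    (hle : (fun a b : Q L F g => a ≤ b) ∈ (relCoding he hA hθ hP).coded)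
    (hlen : (fun a b : Q L F g => a.δ ≤ b.δ) ∈ (relCoding he hA hθ hP).coded)
    {D : Set (Q L F g)} (hD : D ∈ (setCoding he hA).coded) :
    ((setCoding he hA).prod (elemCoding he hA)).Definable fun z => IsReservoir D z.2.δ z.1 := by
  have hlt : ((setCoding he hA).prod (elemCoding he hA)).Definable fun z =>
      ∀ u, u ∈ z.1 → ¬z.2.δ ≤ u.δ :=
    .all (elemCoding he hA) <| .imp (.elem_mem (.snd .id) (.fst (.fst .id))) <|
      .not (definable_length_le hlen (.snd (.fst .id)) (.snd .id))
  have hcov : (setCoding he hA).Definable fun S => ∀ u, u ∈ S → ∀ v, v ⋖ u → v ∈ S :=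
    .all (elemCoding he hA) <| .imp (.elem_mem (.snd .id) (.fst .id)) <|
      .all (elemCoding he hA) <| .imp (.covBy hle (.snd .id) (.snd (.fst .id)))
        (.elem_mem (.snd .id) (.fst (.fst .id)))
  have hext : ((setCoding he hA).prod (elemCoding he hA)).Definable fun z =>
      ∀ u, u ∈ z.1 → ∀ a : Q L F g, u.δ ≤ a.δ → ¬z.2.δ ≤ a.δ →
        ∃ v, v ∈ z.1 ∧ v ≤ u ∧ v.δ ≤ a.δ ∧ a.δ ≤ v.δ :=
    .all (elemCoding he hA) <| .imp (.elem_mem (.snd .id) (.fst (.fst .id))) <|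
      .all (elemCoding he hA) <| .imp (definable_length_le hlen (.snd (.fst .id)) (.snd .id)) <|
        .imp (.not (definable_length_le hlen (.snd (.fst (.fst .id))) (.snd .id))) <|
          .ex (elemCoding he hA) <| .and (.elem_mem (.snd .id) (.fst (.fst (.fst (.fst .id))))) <|
            .and (.le hle (.snd .id) (.snd (.fst (.fst .id)))) <|
              .and (definable_length_le hlen (.snd .id) (.snd (.fst .id)))
                (definable_length_le hlen (.snd (.fst .id)) (.snd .id))
  have hdense : (setCoding he hA).Definable fun S => ∀ u, u ∈ S → ∃ d, d ∈ S ∧ d ∈ D ∧ d ≤ u :=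
    .all (elemCoding he hA) <| .imp (.elem_mem (.snd .id) (.fst .id)) <|
      .ex (elemCoding he hA) <| .and (.elem_mem (.snd .id) (.fst (.fst .id))) <|
        .and (.elem_mem (.snd .id) (.const hD)) (.le hle (.snd .id) (.snd (.fst .id)))
  exact (hlt.and <| (hcov.comp (.fst .id)).and <| hext.and <| hdense.comp (.fst .id)).congr
    fun _ => isReservoir_iff

theorem exists_isReservoir_subset_coded (hF : IsDenseFn F) (hX : langSet.MeetsDefinable A)
    (hle : (fun a b : Q L F g => a ≤ b) ∈ (relCoding he hA hθ hP).coded)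
    {D : Set (Q L F g)} (hD : D ∈ (setCoding he hA).coded) (hdense : DenseIn D) {u b : Q L F g}
    (hu : u ∈ (elemCoding he hA).coded) (hb : b ∈ (elemCoding he hA).coded) :
    ∃ S ⊆ (elemCoding he hA).coded, ∃ c ∈ (elemCoding he hA).coded,
      u ∈ S ∧ b.δ ≤ c.δ ∧ IsReservoir D c.δ S := by
  have hlen := mem_coded_of_isRankLE hle hX isRankLE_length
  obtain ⟨S, c, hS, huS, hbc, hres⟩ := exists_countable_isReservoir hF hdense u b
  have henum := exists_enumerates hS (hres.infinite ⟨u, huS⟩)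
  obtain ⟨⟨S, c⟩, hcoded, henum, h⟩ := exists_mem_coded hX
    (φ := fun z : Set (Q L F g) × Q L F g => (∃ f v, Enumerates f v z.1) ∧
      u ∈ z.1 ∧ b.δ ≤ z.2.δ ∧ IsReservoir D z.2.δ z.1)
    (.and (.ex (relCoding he hA hθ hP) <| .ex (elemCoding he hA) <| definable_enumerates.comp
        (.prodMk (.prodMk (.snd (.fst .id)) (.snd .id)) (.fst (.fst (.fst .id))))) <|
      .and (.elem_mem (.const hu) (.fst .id)) <|
        .and (definable_length_le hlen (.const hb) (.snd .id)) (definable_isReservoir hle hlen hD))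
    ⟨(S, c), henum, huS, hbc, hres⟩
  obtain ⟨hSX, hcX⟩ := prodMk_mem_coded.1 hcoded
  exact ⟨S, subset_coded_of_enumerates hX hθ hP hSX henum, c, hcX, h⟩

end Q

theorem isProper_Q {L : LadderSystem} {F : (ℕ → Fin 2) →. Fin 2} {g : Omega → Fin 2}
    (hF : IsDenseFn F) : IsProper (Q L F g) := by
  intro e θ hθ _ hP he X X' hX hcX hlX p hp
  replace hP : #(Q L F g) < θ := (cantor _).trans hP
  have mem_of_coe_mem : ∀ y : H θ, (y : ZFSet) ∈ X' → y ∈ (X : Set (H θ)) := by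
    rintro y ⟨z, hz, hzy⟩
    exact Subtype.ext hzy ▸ hz
  have hA : (⟨carrierSet e, he⟩ : H θ) ∈ (X : Set (H θ)) := mem_of_coe_mem _ hcX
  have hle : (fun a b : Q L F g => a ≤ b) ∈ (relCoding he hA hθ hP).coded :=
    fun _ => mem_of_coe_mem _ (show relSet e (· ≤ ·) ∈ X' from hlX)
  let Y : Set (Q L F g) := (elemCoding he hA).coded
  have hY : Y.Countable := (hX.preimage_of_injOn e.injective.injOn).mono fun p hp =>
    Set.mem_image_of_mem Subtype.val (hp (0 : Fin 1))
  let 𝒟 : Set ZFSet := {D ∈ X' | D ⊆ carrierSet e ∧ DenseIn {p | e p ∈ D}}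
  have h𝒟 : 𝒟.Nonempty := ⟨carrierSet e, hcX, fun _ => id, fun q =>
    ⟨q, (mem_carrierSet_iff he (toH he q)).2 ⟨q, rfl⟩, le_rfl⟩⟩
  obtain ⟨D, hD⟩ := (hX.mono fun _ h => h.1 : 𝒟.Countable).exists_eq_range h𝒟
  obtain ⟨q, hqp, hq⟩ := Q.exists_le_forall_exists_mem_of_isReservoir hF hY
    (D := fun n => {p | e p ∈ D n}) (fun n u hu b hb => by
      obtain ⟨hDX, hDe, hdense⟩ : D n ∈ 𝒟 := hD ▸ Set.mem_range_self n
      have hcode : subsetSet e {p | e p ∈ D n} ∈ X' := by rwa [subsetSet_setOf hDe]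
      exact Q.exists_isReservoir_subset_coded hF X.meetsDefinable hle
        (fun _ => mem_of_coe_mem _ hcode) hdense hu hb)
    fun _ => mem_of_coe_mem (toH he p) hp
  refine ⟨q, hqp, fun E hEX hEe hE r hr => ?_⟩
  obtain ⟨n, rfl⟩ : E ∈ Set.range D := hD ▸ ⟨hEX, hEe, hE⟩
  obtain ⟨d, hdY, hdE, hqd⟩ := hq n
  exact ⟨d, hdE, ⟨toH he d, hdY (0 : Fin 1), rfl⟩, r, hr.trans hqd, le_rfl⟩

end LadderForcing

open LadderForcing in
theorem mainTheorem7 (L : LadderSystem) (F : (ℕ → Fin 2) →. Fin 2) (hF : IsDenseFn F)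
    (g : Omega → Fin 2) :
    IsProper (Q L F g) ∧ OmegaDistributive (Q L F g) ∧ AddsNoNewReals (Q L F g) :=
  ⟨isProper_Q hF, omegaDistributive_Q hF, (omegaDistributive_Q hF).addsNoNewReals⟩
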